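/- Let $(I,\mathbb A,m)$ be a measure space with $m(I)<\infty$, write $|J|=m(J)$, and let $\mathcal P=(\mathcal P^k)_{k\ge 0}$ be a $(\lambda_1,\lambda_2)$-good grid, $0<\lambda_1<\lambda_2<1$. This means that the $\mathcal P^k$ are finite families of measurable sets of positive measure, with no set belonging to two different levels, such that: $\mathcal P^0=\{I\}$; the elements of each $\mathcal P^k$ are pairwise disjoint and cover $I$ up to a null set; every $Q\in\mathcal P^{k+1}$ is contained in some $P\in\mathcal P^{k}$; $\lambda_1\le |Q|/|P|\le\lambda_2$ whenever $Q\in\mathcal P^{k+1}$, $P\in\mathcal P^k$ and $Q\subset P$; and $\bigcup_k\mathcal P^k$ generates $\mathbb A$. Functions are complex valued and identified when they agree almost everywhere. Let $0<s<1$. The Besov space $\mathcal B^s_{1,1}(\mathcal P)$ is the set of all $f\in L^1$ that have a representation $f=\sum_{k\ge 0}\sum_{Q\in\mathcal P^k}\sigma_Q a_Q$, where $\sigma_Q\in\mathbb C$, $\sum_k\sum_{Q\in\mathcal P^k}|\sigma_Q|<\infty$, each $a_Q$ is a Souza atom on $Q$ (it vanishes outside $Q$ and is constant on $Q$ with absolute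 value at most $|Q|^{s-1}$), and the series over $k$ converges absolutely in $L^1$. Its norm $|f|_{\mathcal B^s_{1,1}}$ is the infimum of $\sum_k\sum_{Q\in\mathcal P^k}|\sigma_Q|$ over all such representations. Fix $C\ge 1$ and $c\in(0,1)$. A measurable set $\Omega\subset I$ containing some element of $\mathcal P$ is a $(1-s,C,c)$-regular domain if, with $k_0=\min\{k:\exists P\in\mathcal P^k,\ P\subset\Omega\}$, there are families $\mathcal F^k\subset\mathcal P^k$, $k\ge k_0$, such that $\Omega=\bigcup_{k\ge k_0}\bigcup_{Q\in\mathcal F^k}Q$, distinct elements of $\bigcup_{k\ge k_0}\mathcal F^k$ are disjoint, and $$\sum_{Q\in\mathcal F^k}|Q|^{1-s}\le C\,c^{\,k-k_0}\,|\Omega|^{1-s}\qquad\text{for every }k\ge k_0 .$$ Let $\hat{\mathcal W}$ be any family of $(1-s,C,c)$-regular domains with $\bigcup_k\mathcal P^k\subset\hat{\mathcal W}$. Let $B^{1-s}$ be the set of all $f\in L^{1/(1-s)}$ that can be written as $$f=\sum_{i=0}^\infty c_i\,\frac{1_{A_i}}{|A_i|^{1-s}},\qquad A_i\in\hat{\mathcal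 W},\ c_i\in\mathbb C,\ \sum_i|c_i|<\infty,$$ with convergence in $L^{1/(1-s)}$, and let $|f|_{B^{1-s}}$ be the infimum of $\sum_i|c_i|$ over all such representations. **Proposition.** We have $B^{1-s}=\mathcal B^s_{1,1}(\mathcal P)$, and the two norms are equivalent: there are constants $K_1,K_2>0$ such that for every $f$ in this space $$|f|_{B^{1-s}}\le K_1\,|f|_{\mathcal B^s_{1,1}}\qquad\text{and}\qquad |f|_{\mathcal B^s_{1,1}}\le K_2\,|f|_{B^{1-s}} .$$ -/

import Mathlib

open MeasureTheory Filter Topology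
open scoped ENNReal NNReal

namespace GridBesov

/-- A grid in the measure space `(I, m)`: a sequence of finite families `G k` of measurable sets of
positive measure, not all empty, with no set occurring at two levels, and such that the number of
elements of `G k` that meet a given element of `G k` is bounded uniformly. -/
structure IsGrid {I : Type*} [MeasurableSpace I] (m : Measure I) (G : ℕ → Finset (Set I)) :
    Prop where
  measurableSet : ∀ k, ∀ Q ∈ G k, MeasurableSet Q
  measure_pos : ∀ k, ∀ Q ∈ G k, 0 < m Q
  exists_nonempty : ∃ k, (G k).Nonempty
  levels_distinct : ∀ i j, i ≠ j → ∀ P ∈ G i, ∀ Q ∈ G j, P ≠ Q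
  bounded_overlap : ∃ N : ℕ, ∀ k, ∀ Q ∈ G k, {P | P ∈ G k ∧ (P ∩ Q).Nonempty}.ncard ≤ N

/-- A `(lam₁, lam₂)`-good grid, `0 < lam₁ < lam₂ < 1`: a nested sequence of finite partitions (up to
null sets) of `I`, starting from `{I}`, with children of size comparable to their parent, that
generates the `σ`-algebra. -/
structure IsGoodGrid {I : Type*} [mI : MeasurableSpace I] (m : Measure I)
    (G : ℕ → Finset (Set I)) (lam₁ lam₂ : ℝ) : Prop extends IsGrid m G where
  lam₁_pos : 0 < lam₁
  lam₁_lt : lam₁ < lam₂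
  lam₂_lt_one : lam₂ < 1
  zero_level : G 0 = {Set.univ}
  ae_cover : ∀ k, m (⋃ Q ∈ G k, Q)ᶜ = 0
  disjoint : ∀ k, ∀ P ∈ G k, ∀ Q ∈ G k, P ≠ Q → Disjoint P Q
  nested : ∀ k, ∀ Q ∈ G (k + 1), ∃ P ∈ G k, Q ⊆ P
  ratio : ∀ k, ∀ P ∈ G k, ∀ Q ∈ G (k + 1), Q ⊆ P →
    lam₁ ≤ m.real Q / m.real P ∧ m.real Q / m.real P ≤ lam₂
  generates : MeasurableSpace.generateFrom {Q | ∃ k, Q ∈ G k} = mI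

/-- An `(s, p)`-Souza atom supported on `Q`: a function that vanishes outside `Q` and is constant on
`Q`, with value bounded by `|Q| ^ (s - 1 / p)`. -/
def IsSouzaAtom {I : Type*} [MeasurableSpace I] (m : Measure I) (s p : ℝ) (Q : Set I)
    (a : I → ℂ) : Prop :=
  ∃ z : ℂ, (∀ x ∈ Q, a x = z) ∧ (∀ x ∉ Q, a x = 0) ∧ ‖z‖ ≤ m.real Q ^ (s - 1 / p)

/-- The cost `∑ₖ ∑_{Q ∈ G k} |σ_Q|`, for the exponents `p = q = 1`. -/
noncomputable def besovCost {I : Type*} (G : ℕ → Finset (Set I)) (σ : Set I → ℂ) : ℝ≥0∞ :=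
  ∑' k, ∑ Q ∈ G k, ‖σ Q‖ₑ

/-- `f = ∑ₖ ∑_{Q ∈ G k} σ_Q a_Q` is a `𝓑^s_{1,1}`-representation: the `a_Q` are `(s, 1)`-Souza atoms,
the cost is finite, and the series (over the levels `k`) converges absolutely in `L¹`, with sum `f`. -/
structure IsBesovRep {I : Type*} [MeasurableSpace I] (m : Measure I) (G : ℕ → Finset (Set I))
    (s : ℝ) (f : I → ℂ) (σ : Set I → ℂ) (a : Set I → I → ℂ) : Prop where
  atom : ∀ k, ∀ Q ∈ G k, IsSouzaAtom m s 1 Q (a Q)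
  cost_lt_top : besovCost G σ < ∞
  abs_conv : ∑' k, eLpNorm (fun x => ∑ Q ∈ G k, σ Q * a Q x) 1 m < ∞
  tendsto : Tendsto
    (fun n => eLpNorm (fun x => f x - ∑ k ∈ Finset.range n, ∑ Q ∈ G k, σ Q * a Q x) 1 m)
    atTop (𝓝 0)

/-- The space `𝓑^s_{1,1}(G)`, as a set of classes of functions modulo a.e. equality. -/
def besovSpace {I : Type*} [MeasurableSpace I] (m : Measure I) (G : ℕ → Finset (Set I))
    (s : ℝ) : Set (I →ₘ[m] ℂ) :=
  {f | MemLp f 1 m ∧ ∃ σ a, IsBesovRep m G s f σ a}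

/-- The norm of `𝓑^s_{1,1}(G)`: the infimum of the costs of all representations. -/
noncomputable def besovNorm {I : Type*} [MeasurableSpace I] (m : Measure I)
    (G : ℕ → Finset (Set I)) (s : ℝ) (f : I →ₘ[m] ℂ) : ℝ≥0∞ :=
  ⨅ (σ : Set I → ℂ) (a : Set I → I → ℂ) (_ : IsBesovRep m G s f σ a), besovCost G σ

/-- `(α, C, c)`-regular domains. Here `k₀` is the first level with an element contained in `Ω`, and
`Ω` is the disjoint union of families `F k ⊆ G k`, `k ≥ k₀`, whose `α`-sums decay geometrically. -/
def IsRegularDomain {I : Type*} [MeasurableSpace I] (m : Measure I) (G : ℕ → Finset (Set I))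
    (α C c : ℝ) (Ω : Set I) : Prop :=
  MeasurableSet Ω ∧ ∃ k₀ : ℕ, IsLeast {k | ∃ P ∈ G k, P ⊆ Ω} k₀ ∧
    ∃ F : ℕ → Finset (Set I),
      (∀ k ≥ k₀, F k ⊆ G k) ∧
      Ω = ⋃ k ≥ k₀, ⋃ Q ∈ F k, Q ∧
      (∀ i ≥ k₀, ∀ j ≥ k₀, ∀ P ∈ F i, ∀ Q ∈ F j, P ≠ Q → Disjoint P Q) ∧
      ∀ k ≥ k₀, ∑ Q ∈ F k, m.real Q ^ α ≤ C * c ^ (k - k₀) * m.real Ω ^ α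

/-- `f = ∑ᵢ cᵢ 1_{Aᵢ} / |Aᵢ| ^ (1 - s)` with `Aᵢ ∈ W` and `∑ᵢ |cᵢ| < ∞`. The series is understood in
`L^{1/(1-s)}`, where each term has norm at most `|cᵢ|`. -/
structure IsDomainRep {I : Type*} [MeasurableSpace I] (m : Measure I) (W : Set (Set I))
    (s : ℝ) (f : I → ℂ) (c : ℕ → ℂ) (A : ℕ → Set I) : Prop where
  mem : ∀ i, A i ∈ W
  cost_lt_top : ∑' i, ‖c i‖ₑ < ∞
  tendsto : Tendsto
    (fun n => eLpNorm (fun x => f x - ∑ i ∈ Finset.range n,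
        c i * ((A i).indicator (fun _ => (1 : ℂ)) x / ((m.real (A i) ^ (1 - s) : ℝ) : ℂ)))
      (ENNReal.ofReal (1 / (1 - s))) m)
    atTop (𝓝 0)

/-- The space `B^{1-s}` defined by the family `W`, as a set of classes of functions modulo a.e.
equality. -/
def domainSpace {I : Type*} [MeasurableSpace I] (m : Measure I) (W : Set (Set I)) (s : ℝ) :
    Set (I →ₘ[m] ℂ) :=
  {f | MemLp f (ENNReal.ofReal (1 / (1 - s))) m ∧ ∃ c A, IsDomainRep m W s f c A}

/-- The norm of `B^{1-s}`: the infimum of `∑ᵢ |cᵢ|` over all representations. -/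
noncomputable def domainNorm {I : Type*} [MeasurableSpace I] (m : Measure I) (W : Set (Set I))
    (s : ℝ) (f : I →ₘ[m] ℂ) : ℝ≥0∞ :=
  ⨅ (c : ℕ → ℂ) (A : ℕ → Set I) (_ : IsDomainRep m W s f c A), ∑' i, ‖c i‖ₑ

end GridBesov

/-!
Every `(s, 1)`-Souza atom on `Q` is a multiple, by a factor of modulus at most one, of the function
`1_Q / |Q| ^ (1 - s)`, whose norm in `L^{1/(1-s)}` is at most one. So both norms are atomic norms in
that Lebesgue space, over the cells of the grid and over the sets in `W` respectively, and all
series of atoms with summable coefficients converge there. As every cell belongs to `W`, the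
`B^{1-s}` norm is at most the Besov norm. Conversely, the cells in the decomposition of a regular
domain `Ω` give `1_Ω / |Ω| ^ (1 - s) = ∑ₖ ∑_{Q ∈ F k} (|Q| / |Ω|) ^ (1 - s) 1_Q / |Q| ^ (1 - s)`,
with coefficient sum at most `∑ⱼ C c ^ j = C / (1 - c)`. Substituting these expansions into a
series over `W` multiplies its cost by at most `C / (1 - c)`.
-/

namespace GridBesov

section AtomicNorm

variable {𝕜 E ι κ : Type*} [NormedField 𝕜] [NormedAddCommGroup E] [NormedSpace 𝕜 E]
  {u : κ → E} {f : E}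

/-- The atomic norm of `f` with respect to a family `u` of atoms: the infimum of `∑ᵢ |cᵢ|` over all
unconditionally convergent expansions `f = ∑ᵢ cᵢ uᵢ`, and `∞` if `f` has no such expansion. -/
noncomputable def atomicNorm (𝕜 : Type*) [NormedField 𝕜] [NormedSpace 𝕜 E] (u : κ → E) (f : E) :
    ℝ≥0∞ :=
  ⨅ (c : κ → 𝕜) (_ : HasSum (fun i => c i • u i) f), ∑' i, ‖c i‖ₑ

theorem atomicNorm_le_tsum {c : κ → 𝕜} (h : HasSum (fun i => c i • u i) f) :
    atomicNorm 𝕜 u f ≤ ∑' i, ‖c i‖ₑ :=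
  iInf₂_le c h

theorem summable_smul_of_norm_le [CompleteSpace E] {M : ℝ} (hu : ∀ i, ‖u i‖ ≤ M) {c : κ → 𝕜}
    (hc : ∑' i, ‖c i‖ₑ ≠ ∞) : Summable fun i => c i • u i := by
  refine ((tsum_enorm_ne_top_iff_summable_norm.1 hc).mul_right M).of_norm_bounded fun i => ?_
  exact (norm_smul_le _ _).trans (mul_le_mul_of_nonneg_left (hu i) (norm_nonneg _))

theorem tsum_enorm_extend_zero {e : ι → κ} (he : e.Injective) (c : ι → E) :
    ∑' k, ‖Function.extend e c 0 k‖ₑ = ∑' i, ‖c i‖ₑ := by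
  rw [← tsum_extend_zero he]
  refine tsum_congr fun k => ?_
  by_cases hk : ∃ i, e i = k
  · obtain ⟨i, rfl⟩ := hk
    rw [he.extend_apply, he.extend_apply]
  · rw [Function.extend_apply' _ _ _ hk, Function.extend_apply' _ _ _ hk, Pi.zero_apply,
      Pi.zero_apply, enorm_zero]

theorem hasSum_extend_zero_smul {e : ι → κ} (he : e.Injective) {c : ι → 𝕜} :
    HasSum (fun k => Function.extend e c 0 k • u k) f ↔ HasSum (fun i => c i • u (e i)) f := by
  rw [← he.hasSum_iff]
  · simp only [Function.comp_def, he.extend_apply]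
  · intro k hk
    rw [Function.extend_apply' _ _ _ hk, Pi.zero_apply, zero_smul]

theorem exists_nat_hasSum_smul [Nonempty κ] {c : κ → 𝕜} (hc : ∑' k, ‖c k‖ₑ ≠ ∞)
    (hf : HasSum (fun k => c k • u k) f) :
    ∃ (b : ℕ → 𝕜) (i : ℕ → κ), HasSum (fun n => b n • u (i n)) f ∧
      ∑' n, ‖b n‖ₑ = ∑' k, ‖c k‖ₑ := by
  have hsupp : (Function.support fun k => ‖c k‖ₑ) = Function.support c := by
    ext k
    simp only [Function.mem_support, ne_eq, enorm_eq_zero]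
  have : Countable (Function.support c) := hsupp ▸ Summable.countable_support_ennreal hc
  obtain ⟨e, he⟩ := exists_injective_nat (Function.support c)
  refine ⟨Function.extend e (fun k => c k) 0,
    Function.extend e (fun k => k) fun _ => Classical.arbitrary κ, ?_, ?_⟩
  · simp only [hasSum_extend_zero_smul he, he.extend_apply]
    refine (hasSum_subtype_iff_of_support_subset ?_).2 hf
    exact Function.support_smul_subset_left c u
  · rw [tsum_enorm_extend_zero he, tsum_subtype (Function.support c) fun k => ‖c k‖ₑ, ← hsupp,
      Set.indicator_support]

variable [CompleteSpace E] [CompleteSpace 𝕜] {v : ι → E} {K : ℝ≥0∞} {M : ℝ}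

theorem exists_hasSum_smul_of_hasSum_smul (hu : ∀ k, ‖u k‖ ≤ M) (hK : K ≠ ∞) {d : ι → κ → 𝕜}
    (hv : ∀ i, HasSum (fun k => d i k • u k) (v i)) (hd : ∀ i, ∑' k, ‖d i k‖ₑ ≤ K) {b : ι → 𝕜}
    (hb : ∑' i, ‖b i‖ₑ ≠ ∞) (hf : HasSum (fun i => b i • v i) f) :
    ∃ τ : κ → 𝕜, HasSum (fun k => τ k • u k) f ∧ ∑' k, ‖τ k‖ₑ ≤ K * ∑' i, ‖b i‖ₑ := by
  have hcost : ∑' y : ι × κ, ‖b y.1 * d y.1 y.2‖ₑ ≤ K * ∑' i, ‖b i‖ₑ := by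
    rw [ENNReal.tsum_prod', ← ENNReal.tsum_mul_left]
    refine ENNReal.tsum_le_tsum fun i => ?_
    simp only [enorm_mul]
    rw [ENNReal.tsum_mul_left, mul_comm K]
    gcongr
    exact hd i
  have hfin : ∑' y : ι × κ, ‖b y.1 * d y.1 y.2‖ₑ ≠ ∞ :=
    ne_top_of_le_ne_top (ENNReal.mul_ne_top hK hb) hcost
  have hcoeff : Summable fun y : ι × κ => b y.1 * d y.1 y.2 :=
    (tsum_enorm_ne_top_iff_summable_norm.1 hfin).of_norm
  have hdouble : HasSum (fun y : ι × κ => (b y.1 * d y.1 y.2) • u y.2) f := by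
    obtain ⟨g, hg⟩ := summable_smul_of_norm_le (u := fun y : ι × κ => u y.2)
      (fun y => hu y.2) hfin
    have hgf : g = f := by
      refine (hg.prod_fiberwise fun i => ?_).unique hf
      simpa only [mul_smul] using (hv i).const_smul (b i)
    exact hgf ▸ hg
  refine ⟨fun k => ∑' i, b i * d i k, ?_, le_trans ?_ hcost⟩
  · refine ((Equiv.prodComm κ ι).hasSum_iff.2 hdouble).prod_fiberwise fun k => ?_
    exact (hcoeff.comp_injective (Prod.mk_left_injective k)).hasSum.smul_const (u k)
  · rw [ENNReal.tsum_prod', ENNReal.tsum_comm]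
    exact ENNReal.tsum_le_tsum fun k => enorm_tsum_le_tsum_enorm

theorem atomicNorm_le_mul (hu : ∀ k, ‖u k‖ ≤ M) (hK₀ : K ≠ 0) (hK : K ≠ ∞)
    (hv : ∀ i, ∃ d : κ → 𝕜, HasSum (fun k => d k • u k) (v i) ∧ ∑' k, ‖d k‖ₑ ≤ K) (f : E) :
    atomicNorm 𝕜 u f ≤ K * atomicNorm 𝕜 v f := by
  choose d hd hdK using hv
  simp only [atomicNorm, ENNReal.mul_iInf_of_ne hK₀ hK]
  refine le_iInf₂ fun b hf => ?_
  rcases eq_or_ne (∑' i, ‖b i‖ₑ) ∞ with hb | hb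
  · rw [hb, ENNReal.mul_top hK₀]
    exact le_top
  · obtain ⟨τ, hτ, hcost⟩ := exists_hasSum_smul_of_hasSum_smul hu hK hd hdK hb hf
    exact (atomicNorm_le_tsum hτ).trans hcost

theorem atomicNorm_le_atomicNorm_comp (hu : ∀ k, ‖u k‖ ≤ M) (e : ι → κ) (f : E) :
    atomicNorm 𝕜 u f ≤ atomicNorm 𝕜 (fun i => u (e i)) f := by
  classical
  rw [← one_mul (atomicNorm 𝕜 (fun i => u (e i)) f)]
  refine atomicNorm_le_mul hu one_ne_zero ENNReal.one_ne_top
    (fun i => ⟨Pi.single (e i) 1, ?_, ?_⟩) f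
  · convert! hasSum_single (e i) fun k hk => ?_
    · rw [Pi.single_eq_same, one_smul]
    · rw [Pi.single_eq_of_ne hk, zero_smul]
  · rw [tsum_eq_single (e i) fun k hk => by rw [Pi.single_eq_of_ne hk, enorm_zero],
      Pi.single_eq_same, enorm_one]

end AtomicNorm

section Lp

variable {I E ι : Type*} [MeasurableSpace I] [NormedAddCommGroup E] {m : Measure I} {p : ℝ≥0∞}

theorem tendsto_eLpNorm_sub_iff [Fact (1 ≤ p)] {f : Lp E p m} {u : ℕ → Lp E p m}
    {g : ℕ → I → E} (h : ∀ n, u n =ᵐ[m] g n) :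
    Tendsto (fun n => eLpNorm (fun x => f x - g n x) p m) atTop (𝓝 0) ↔
      Tendsto u atTop (𝓝 f) := by
  rw [Lp.tendsto_Lp_iff_tendsto_eLpNorm']
  refine tendsto_congr fun n => ?_
  rw [eLpNorm_sub_comm]
  exact eLpNorm_congr_ae ((EventuallyEq.refl _ _).sub (h n).symm)

theorem exists_eLpNorm_le_mul_eLpNorm (E : Type*) [NormedAddCommGroup E] (m : Measure I)
    [IsFiniteMeasure m] {q : ℝ≥0∞} (hq : q ≠ 0) (hqp : q ≤ p) :
    ∃ M : ℝ≥0∞, M ≠ ∞ ∧ ∀ f : I → E, AEStronglyMeasurable f m →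
      eLpNorm f q m ≤ M * eLpNorm f p m := by
  refine ⟨m Set.univ ^ (1 / q.toReal - 1 / p.toReal), ?_, fun f hf =>
    (eLpNorm_le_eLpNorm_mul_rpow_measure_univ hqp hf).trans_eq (mul_comm _ _)⟩
  refine ENNReal.rpow_ne_top_of_nonneg (sub_nonneg.2 ?_) (measure_ne_top m _)
  rcases eq_or_ne p ∞ with rfl | hp
  · rw [ENNReal.toReal_top, div_zero]
    positivity
  · exact one_div_le_one_div_of_le
      (ENNReal.toReal_pos hq (ne_top_of_le_ne_top hp hqp)) (ENNReal.toReal_mono hp hqp)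

theorem sum_indicatorConstLp_of_pairwise_disjoint {B : ι → Set I}
    (hB : ∀ i, MeasurableSet (B i)) (hBm : ∀ i, m (B i) ≠ ∞)
    (hd : Pairwise (Function.onFun Disjoint B)) (z : E) (t : Finset ι)
    (ht : MeasurableSet (⋃ i ∈ t, B i)) (htm : m (⋃ i ∈ t, B i) ≠ ∞) :
    ∑ i ∈ t, indicatorConstLp p (hB i) (hBm i) z = indicatorConstLp p ht htm z := by
  classical
  induction t using Finset.induction_on with
  | empty => simp
  | insert a t ha ih =>
    have hsub : ⋃ i ∈ t, B i ⊆ ⋃ i ∈ insert a t, B i :=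
      Set.biUnion_subset_biUnion_left (Finset.subset_insert a t)
    rw [Finset.sum_insert ha, ih (t.measurableSet_biUnion fun i _ => hB i)
      (measure_ne_top_of_subset hsub htm), ← indicatorConstLp_disjoint_union]
    · simp only [Finset.set_biUnion_insert]
    · exact Set.disjoint_iUnion₂_right.2 fun i hi => hd fun h => ha (h ▸ hi)

theorem tendsto_measure_symmDiff_biUnion_finset [Countable ι] {B : ι → Set I}
    (hB : ∀ i, MeasurableSet (B i)) (hU : m (⋃ i, B i) ≠ ∞) :
    Tendsto (fun t : Finset ι => m (symmDiff (⋃ i ∈ t, B i) (⋃ i, B i))) atTop (𝓝 0) := by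
  have hmono : Monotone fun t : Finset ι => ⋃ i ∈ t, B i := fun t u h =>
    Set.biUnion_subset_biUnion_left h
  have hlim := tendsto_measure_iUnion_atTop (μ := m) hmono
  rw [← Set.iUnion_eq_iUnion_finset B] at hlim
  have hdiff := ENNReal.Tendsto.sub (tendsto_const_nhds (x := m (⋃ i, B i))) hlim (.inl hU)
  rw [tsub_self] at hdiff
  refine hdiff.congr fun t => ?_
  have hsub : ⋃ i ∈ t, B i ⊆ ⋃ i, B i := Set.iUnion₂_subset_iUnion _ _
  rw [Set.symmDiff_def, Set.sdiff_eq_empty.2 hsub, Set.empty_union, measure_sdiff hsub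
    (t.measurableSet_biUnion fun i _ => hB i).nullMeasurableSet
    (measure_ne_top_of_subset hsub hU), Function.comp_apply]

theorem hasSum_indicatorConstLp_iUnion [Fact (1 ≤ p)] (hp : p ≠ ∞) [Countable ι] {B : ι → Set I}
    (hB : ∀ i, MeasurableSet (B i)) (hd : Pairwise (Function.onFun Disjoint B))
    (hU : m (⋃ i, B i) ≠ ∞) (z : E) :
    HasSum
      (fun i => indicatorConstLp p (hB i) (measure_ne_top_of_subset (Set.subset_iUnion B i) hU) z)
      (indicatorConstLp p (.iUnion hB) hU z) := by
  have hUt : ∀ t : Finset ι, m (⋃ i ∈ t, B i) ≠ ∞ := fun t =>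
    measure_ne_top_of_subset (Set.iUnion₂_subset_iUnion _ _) hU
  rw [HasSum, SummationFilter.unconditional_filter]
  simp only [fun t : Finset ι => sum_indicatorConstLp_of_pairwise_disjoint (p := p) hB
    (fun i => measure_ne_top_of_subset (Set.subset_iUnion B i) hU) hd z t
    (t.measurableSet_biUnion fun i _ => hB i) (hUt t)]
  exact tendsto_indicatorConstLp_set hp (tendsto_measure_symmDiff_biUnion_finset hB hU)

end Lp

section SouzaAtom

variable {I : Type*} [MeasurableSpace I] {m : Measure I} {s : ℝ} {Q : Set I}

/-- The exponent of the Lebesgue space in which `B^{1-s}` lives. -/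
noncomputable abbrev domainExponent (s : ℝ) : ℝ≥0∞ := ENNReal.ofReal (1 / (1 - s))

theorem one_le_domainExponent (hs₀ : 0 ≤ s) (hs₁ : s < 1) : 1 ≤ domainExponent s := by
  rw [ENNReal.one_le_ofReal, le_div_iff₀ (sub_pos.2 hs₁)]
  linarith

theorem one_div_toReal_domainExponent [hs : Fact (1 ≤ domainExponent s)] :
    1 / (domainExponent s).toReal = 1 - s := by
  have hpos : 0 < 1 / (1 - s) := one_pos.trans_le (ENNReal.one_le_ofReal.1 hs.out)
  rw [ENNReal.toReal_ofReal hpos.le, one_div_one_div]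

/-- The function `1_Q / |Q| ^ (1 - s)`, which is the largest `(s, 1)`-Souza atom on `Q`. It is `0`
if `|Q| = 0` and `s ≠ 1`. -/
noncomputable def souzaAtom (m : Measure I) (s : ℝ) (Q : Set I) : I → ℂ :=
  fun x => Q.indicator (fun _ => (1 : ℂ)) x / ((m.real Q ^ (1 - s) : ℝ) : ℂ)

theorem isSouzaAtom_souzaAtom : IsSouzaAtom m s 1 Q (souzaAtom m s Q) := by
  refine ⟨((m.real Q ^ (1 - s) : ℝ) : ℂ)⁻¹, fun x hx => by simp [souzaAtom, hx],
    fun x hx => by simp [souzaAtom, hx], ?_⟩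
  rw [norm_inv, Complex.norm_real, Real.norm_of_nonneg (by positivity),
    ← Real.rpow_neg measureReal_nonneg, neg_sub, div_one]

theorem IsSouzaAtom.exists_eq_mul_souzaAtom {a : I → ℂ} (h : IsSouzaAtom m s 1 Q a)
    (hQ : 0 < m.real Q) : ∃ θ : ℂ, ‖θ‖ ≤ 1 ∧ ∀ x, a x = θ * souzaAtom m s Q x := by
  obtain ⟨z, hz, hz₀, hzn⟩ := h
  have hpow : 0 < m.real Q ^ (1 - s) := Real.rpow_pos_of_pos hQ _
  refine ⟨z * ((m.real Q ^ (1 - s) : ℝ) : ℂ), ?_, fun x => ?_⟩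
  · rw [norm_mul, Complex.norm_real, Real.norm_of_nonneg hpow.le]
    calc ‖z‖ * m.real Q ^ (1 - s) ≤ m.real Q ^ (s - 1 / 1) * m.real Q ^ (1 - s) := by gcongr
      _ = 1 := by rw [← Real.rpow_add hQ, div_one, sub_add_sub_cancel, sub_self, Real.rpow_zero]
  · by_cases hx : x ∈ Q
    · have hne : ((m.real Q ^ (1 - s) : ℝ) : ℂ) ≠ 0 := Complex.ofReal_ne_zero.2 hpow.ne'
      rw [hz x hx, souzaAtom, Set.indicator_of_mem hx]
      field_simp
    · rw [hz₀ x hx, souzaAtom, Set.indicator_of_notMem hx, zero_div, mul_zero]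

variable [IsFiniteMeasure m]

/-- The Souza atom `1_Q / |Q| ^ (1 - s)` as an element of `L^{1/(1-s)}`. -/
noncomputable def souzaAtomLp (s : ℝ) (hQ : MeasurableSet Q) : Lp ℂ (domainExponent s) m :=
  indicatorConstLp _ hQ (measure_ne_top m Q) ((m.real Q ^ (1 - s) : ℝ) : ℂ)⁻¹

theorem souzaAtomLp_coeFn (hQ : MeasurableSet Q) :
    (souzaAtomLp s hQ : Lp ℂ _ m) =ᵐ[m] souzaAtom m s Q := by
  refine indicatorConstLp_coeFn.trans (.of_forall fun x => ?_)
  by_cases hx : x ∈ Q <;> simp [souzaAtom, hx]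

theorem smul_souzaAtomLp_coeFn (c : ℂ) (hQ : MeasurableSet Q) :
    ⇑(c • souzaAtomLp s hQ : Lp ℂ _ m) =ᵐ[m] fun x => c * souzaAtom m s Q x :=
  (Lp.coeFn_smul c _).trans ((souzaAtomLp_coeFn hQ).const_smul c)

theorem smul_souzaAtomLp (c : ℂ) (hQ : MeasurableSet Q) :
    (c • souzaAtomLp s hQ : Lp ℂ _ m) =
      indicatorConstLp _ hQ (measure_ne_top m Q) (c * ((m.real Q ^ (1 - s) : ℝ) : ℂ)⁻¹) := by
  refine Lp.ext ((smul_souzaAtomLp_coeFn c hQ).trans (.trans (.of_forall fun x => ?_)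
    indicatorConstLp_coeFn.symm))
  by_cases hx : x ∈ Q <;> simp [souzaAtom, hx]

theorem norm_souzaAtomLp_le_one [Fact (1 ≤ domainExponent s)] (hQ : MeasurableSet Q) :
    ‖(souzaAtomLp s hQ : Lp ℂ _ m)‖ ≤ 1 := by
  refine norm_indicatorConstLp_le.trans ?_
  rw [one_div_toReal_domainExponent, norm_inv, Complex.norm_real,
    Real.norm_of_nonneg (by positivity)]
  exact inv_mul_le_one

theorem hasSum_smul_souzaAtomLp_of_iUnion_eq [Fact (1 ≤ domainExponent s)] {ι : Type*}
    [Countable ι] {B : ι → Set I} (hB : ∀ i, MeasurableSet (B i)) (hpos : ∀ i, 0 < m.real (B i))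
    (hd : Pairwise (Function.onFun Disjoint B)) (hQ : MeasurableSet Q) (hBQ : ⋃ i, B i = Q) :
    HasSum (fun i => ((m.real (B i) ^ (1 - s) / m.real Q ^ (1 - s) : ℝ) : ℂ) •
      (souzaAtomLp s (hB i) : Lp ℂ _ m)) (souzaAtomLp s hQ) := by
  subst hBQ
  refine (hasSum_indicatorConstLp_iUnion (p := domainExponent s) ENNReal.ofReal_ne_top hB hd
    (measure_ne_top m _) ((m.real (⋃ i, B i) ^ (1 - s) : ℝ) : ℂ)⁻¹).congr_fun fun i => ?_
  have hne : ((m.real (B i) ^ (1 - s) : ℝ) : ℂ) ≠ 0 :=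
    Complex.ofReal_ne_zero.2 (Real.rpow_pos_of_pos (hpos i) _).ne'
  rw [smul_souzaAtomLp, Complex.ofReal_div, div_mul_eq_mul_div, mul_inv_cancel₀ hne, one_div]

end SouzaAtom

section Cell

variable {I : Type*} {G : ℕ → Finset (Set I)}

/-- The elements of all levels of `G`, indexed by level. -/
abbrev Cell (G : ℕ → Finset (Set I)) : Type _ := Σ k, {Q // Q ∈ G k}

theorem Cell.tsum_eq (φ : Set I → ℝ≥0∞) : ∑' x : Cell G, φ x.2 = ∑' k, ∑ Q ∈ G k, φ Q := by
  rw [ENNReal.tsum_sigma']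
  refine tsum_congr fun k => ?_
  rw [tsum_fintype, Finset.sum_coe_sort (G k) φ]

theorem Cell.coe_injective (h : ∀ i j, i ≠ j → ∀ P ∈ G i, ∀ Q ∈ G j, P ≠ Q) :
    Function.Injective fun x : Cell G => (x.2 : Set I) := by
  rintro ⟨i, P, hP⟩ ⟨j, Q, hQ⟩ (rfl : P = Q)
  obtain rfl : i = j := by_contra fun hij => h i j hij P hP P hQ rfl
  rfl

variable [MeasurableSpace I] {m : Measure I} {p : ℝ≥0∞} {u : Cell G → Lp ℂ p m}
  {v : Set I → I → ℂ}

theorem sum_level_coeFn (h : ∀ x : Cell G, u x =ᵐ[m] v x.2) (k : ℕ) :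
    ⇑(∑ Q : {Q // Q ∈ G k}, u ⟨k, Q⟩) =ᵐ[m] fun x => ∑ Q ∈ G k, v Q x := by
  refine (Lp.coeFn_fun_finsetSum _ _).trans ?_
  filter_upwards [ae_all_iff.2 fun Q : {Q // Q ∈ G k} => h ⟨k, Q⟩] with x hx
  rw [Finset.sum_congr rfl fun Q _ => hx Q, Finset.sum_coe_sort (G k) fun Q => v Q x]

theorem sum_range_sum_level_coeFn (h : ∀ x : Cell G, u x =ᵐ[m] v x.2) (n : ℕ) :
    ⇑(∑ k ∈ Finset.range n, ∑ Q : {Q // Q ∈ G k}, u ⟨k, Q⟩) =ᵐ[m]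
      fun x => ∑ k ∈ Finset.range n, ∑ Q ∈ G k, v Q x := by
  refine (Lp.coeFn_fun_finsetSum _ _).trans ?_
  filter_upwards [ae_all_iff.2 fun k => sum_level_coeFn h k] with x hx
  exact Finset.sum_congr rfl fun k _ => hx k

theorem tendsto_eLpNorm_one_sub_sum_level [IsFiniteMeasure m] [hp : Fact (1 ≤ p)]
    (h : ∀ x : Cell G, u x =ᵐ[m] v x.2) {g : Lp ℂ p m} (hg : HasSum u g) :
    Tendsto (fun n => eLpNorm (fun x => g x - ∑ k ∈ Finset.range n, ∑ Q ∈ G k, v Q x) 1 m)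
      atTop (𝓝 0) := by
  have hlim := (tendsto_eLpNorm_sub_iff (sum_range_sum_level_coeFn h)).2
    (hg.sigma fun _ => hasSum_fintype _).tendsto_sum_nat
  obtain ⟨M, hM, hle⟩ := exists_eLpNorm_le_mul_eLpNorm ℂ m one_ne_zero hp.out
  have hbound := ENNReal.Tendsto.const_mul hlim (.inr hM)
  rw [mul_zero] at hbound
  refine tendsto_of_tendsto_of_tendsto_of_le_of_le tendsto_const_nhds hbound (fun _ => zero_le)
    fun n => hle _ ((Lp.aestronglyMeasurable g).sub ?_)
  exact (Lp.aestronglyMeasurable _).congr (sum_range_sum_level_coeFn h n)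

end Cell

section BesovSpace

variable {I : Type*} [MeasurableSpace I] {m : Measure I} {G : ℕ → Finset (Set I)} {s : ℝ}

theorem besovNorm_le {f : I →ₘ[m] ℂ} {σ : Set I → ℂ} {a : Set I → I → ℂ}
    (h : IsBesovRep m G s f σ a) : besovNorm m G s f ≤ besovCost G σ :=
  (iInf₂_le σ a).trans (iInf_le _ h)

variable [IsFiniteMeasure m]

/-- The Souza atoms of the cells of a grid, as a family of atoms in `L^{1/(1-s)}`. -/
noncomputable def cellAtom (hG : IsGrid m G) (s : ℝ) (x : Cell G) : Lp ℂ (domainExponent s) m :=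
  souzaAtomLp s (hG.measurableSet x.1 x.2 x.2.2)

theorem IsGrid.measureReal_pos (hG : IsGrid m G) (x : Cell G) : 0 < m.real x.2 :=
  ENNReal.toReal_pos (hG.measure_pos x.1 x.2 x.2.2).ne' (measure_ne_top m _)

theorem exists_smul_cellAtom_ae_eq (hG : IsGrid m G) {σ : Set I → ℂ} {a : Set I → I → ℂ}
    (ha : ∀ k, ∀ Q ∈ G k, IsSouzaAtom m s 1 Q (a Q)) :
    ∃ b : Cell G → ℂ, ∑' x, ‖b x‖ₑ ≤ besovCost G σ ∧
      ∀ x, b x • cellAtom hG s x =ᵐ[m] fun y => σ x.2 * a x.2 y := by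
  choose θ hθ hθa using fun x : Cell G =>
    (ha x.1 x.2 x.2.2).exists_eq_mul_souzaAtom (hG.measureReal_pos x)
  refine ⟨fun x => σ x.2 * θ x, ?_, fun x => ?_⟩
  · rw [besovCost, ← Cell.tsum_eq fun Q => ‖σ Q‖ₑ]
    refine ENNReal.tsum_le_tsum fun x => ?_
    rw [enorm_le_iff_norm_le, norm_mul]
    exact mul_le_of_le_one_right (norm_nonneg _) (hθ x)
  · refine (smul_souzaAtomLp_coeFn _ _).trans (.of_forall fun y => ?_)
    simp only [hθa x y, mul_assoc]

variable [hs : Fact (1 ≤ domainExponent s)]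

theorem norm_cellAtom_le_one (hG : IsGrid m G) (x : Cell G) : ‖cellAtom hG s x‖ ≤ 1 :=
  norm_souzaAtomLp_le_one _

theorem tsum_eLpNorm_one_sum_level_lt_top (hG : IsGrid m G) {σ : Set I → ℂ}
    (hσ : besovCost G σ < ∞) :
    ∑' k, eLpNorm (fun x => ∑ Q ∈ G k, σ Q * souzaAtom m s Q x) 1 m < ∞ := by
  obtain ⟨M, hM, hle⟩ := exists_eLpNorm_le_mul_eLpNorm ℂ m one_ne_zero hs.out
  refine lt_of_le_of_lt ?_ (ENNReal.mul_lt_top hM.lt_top hσ)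
  rw [besovCost, ← ENNReal.tsum_mul_left]
  refine ENNReal.tsum_le_tsum fun k => ?_
  rw [← eLpNorm_congr_ae (sum_level_coeFn (u := fun x => σ x.2 • cellAtom hG s x)
    (v := fun Q y => σ Q * souzaAtom m s Q y) (fun x => smul_souzaAtomLp_coeFn _ _) k)]
  calc eLpNorm (∑ Q : {Q // Q ∈ G k}, σ Q • cellAtom hG s ⟨k, Q⟩ : Lp ℂ _ m) 1 m
    _ ≤ M * ‖∑ Q : {Q // Q ∈ G k}, σ Q • cellAtom hG s ⟨k, Q⟩‖ₑ := by
        rw [Lp.enorm_def]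
        exact hle _ (Lp.aestronglyMeasurable _)
    _ ≤ M * ∑ Q : {Q // Q ∈ G k}, ‖σ Q‖ₑ := by
        gcongr
        refine (enorm_sum_le _ _).trans (Finset.sum_le_sum fun Q _ => ?_)
        rw [enorm_le_iff_norm_le]
        exact (norm_smul_le _ _).trans
          (mul_le_of_le_one_right (norm_nonneg _) (norm_cellAtom_le_one hG _))
    _ = M * ∑ Q ∈ G k, ‖σ Q‖ₑ := by rw [Finset.sum_coe_sort (G k) fun Q => ‖σ Q‖ₑ]

theorem isBesovRep_souzaAtom (hG : IsGrid m G) {σ : Set I → ℂ} (hσ : besovCost G σ < ∞)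
    {f : Lp ℂ (domainExponent s) m}
    (hf : HasSum (fun x : Cell G => σ x.2 • cellAtom hG s x) f) :
    IsBesovRep m G s f σ (souzaAtom m s) where
  atom _ _ _ := isSouzaAtom_souzaAtom
  cost_lt_top := hσ
  abs_conv := tsum_eLpNorm_one_sum_level_lt_top hG hσ
  tendsto := tendsto_eLpNorm_one_sub_sum_level (v := fun Q y => σ Q * souzaAtom m s Q y)
    (fun _ => smul_souzaAtomLp_coeFn _ _) hf

theorem exists_isBesovRep_of_hasSum (hG : IsGrid m G) {τ : Cell G → ℂ} (hτ : ∑' x, ‖τ x‖ₑ < ∞)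
    {f : Lp ℂ (domainExponent s) m} (hf : HasSum (fun x => τ x • cellAtom hG s x) f) :
    ∃ σ a, IsBesovRep m G s f σ a ∧ besovCost G σ = ∑' x, ‖τ x‖ₑ := by
  have hinj := Cell.coe_injective hG.levels_distinct
  let σ : Set I → ℂ := Function.extend (fun x : Cell G => (x.2 : Set I)) τ 0
  have hσ : ∀ x : Cell G, σ x.2 = τ x := hinj.extend_apply τ 0
  have hcost : besovCost G σ = ∑' x, ‖τ x‖ₑ := by
    rw [besovCost, ← Cell.tsum_eq fun Q => ‖σ Q‖ₑ]
    simp only [hσ]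
  refine ⟨σ, souzaAtom m s, isBesovRep_souzaAtom hG (hcost ▸ hτ) ?_, hcost⟩
  simpa only [hσ] using hf

theorem IsBesovRep.exists_hasSum (hG : IsGrid m G) {f : I →ₘ[m] ℂ} {σ : Set I → ℂ}
    {a : Set I → I → ℂ} (h : IsBesovRep m G s f σ a) :
    ∃ (g : Lp ℂ (domainExponent s) m) (b : Cell G → ℂ), (g : I →ₘ[m] ℂ) = f ∧
      HasSum (fun x => b x • cellAtom hG s x) g ∧ ∑' x, ‖b x‖ₑ ≤ besovCost G σ := by
  obtain ⟨b, hcost, hba⟩ := exists_smul_cellAtom_ae_eq hG (σ := σ) h.atom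
  obtain ⟨g, hg⟩ := summable_smul_of_norm_le (norm_cellAtom_le_one (s := s) hG)
    (hcost.trans_lt h.cost_lt_top).ne
  refine ⟨g, b, AEEqFun.ext ?_, hg, hcost⟩
  -- The level sums tend to both `g` and `f` in `L¹`, hence in measure, where limits are unique.
  have hpartial : ∀ n, AEStronglyMeasurable
      (fun x => ∑ k ∈ Finset.range n, ∑ Q ∈ G k, σ Q * a Q x) m := fun n =>
    (Lp.aestronglyMeasurable _).congr
      (sum_range_sum_level_coeFn (v := fun Q y => σ Q * a Q y) hba n)
  have hinMeasure : ∀ φ : I →ₘ[m] ℂ,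
      Tendsto (fun n => eLpNorm (fun x => φ x - ∑ k ∈ Finset.range n, ∑ Q ∈ G k, σ Q * a Q x) 1 m)
        atTop (𝓝 0) →
      TendstoInMeasure m (fun n x => ∑ k ∈ Finset.range n, ∑ Q ∈ G k, σ Q * a Q x) atTop φ := by
    refine fun φ hφ => tendstoInMeasure_of_tendsto_eLpNorm one_ne_zero hpartial
      φ.aestronglyMeasurable (hφ.congr fun n => ?_)
    exact eLpNorm_sub_comm ..
  exact tendstoInMeasure_ae_unique
    (hinMeasure g (tendsto_eLpNorm_one_sub_sum_level (v := fun Q y => σ Q * a Q y) hba hg))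
    (hinMeasure f h.tendsto)

theorem besovNorm_coe (hG : IsGrid m G) (f : Lp ℂ (domainExponent s) m) :
    besovNorm m G s f = atomicNorm ℂ (cellAtom hG s) f := by
  refine le_antisymm (le_iInf₂ fun τ hτ => ?_) (le_iInf₂ fun σ a => le_iInf fun h => ?_)
  · rcases eq_top_or_lt_top (∑' x, ‖τ x‖ₑ) with htop | hlt
    · exact htop ▸ le_top
    · obtain ⟨σ, a, hrep, hcost⟩ := exists_isBesovRep_of_hasSum hG hlt hτ
      exact hcost ▸ besovNorm_le hrep
  · obtain ⟨g, b, hgf, hb, hcost⟩ := h.exists_hasSum hG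
    obtain rfl : g = f := Subtype.ext hgf
    exact (atomicNorm_le_tsum hb).trans hcost

theorem mem_besovSpace_iff (hG : IsGrid m G) {f : I →ₘ[m] ℂ} :
    f ∈ besovSpace m G s ↔ f ∈ Lp ℂ (domainExponent s) m ∧ besovNorm m G s f < ∞ := by
  constructor
  · rintro ⟨-, σ, a, h⟩
    obtain ⟨g, -, rfl, -⟩ := h.exists_hasSum hG
    exact ⟨g.2, (besovNorm_le h).trans_lt h.cost_lt_top⟩
  · rintro ⟨hf, hlt⟩
    simp only [besovNorm, iInf_lt_iff] at hlt
    obtain ⟨σ, a, h, -⟩ := hlt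
    exact ⟨(Lp.mem_Lp_iff_memLp.1 hf).mono_exponent hs.out, σ, a, h⟩

end BesovSpace

section DomainSpace

variable {I : Type*} [MeasurableSpace I] {m : Measure I} {W : Set (Set I)} {s : ℝ}

theorem domainNorm_le {f : I →ₘ[m] ℂ} {c : ℕ → ℂ} {A : ℕ → Set I}
    (h : IsDomainRep m W s f c A) : domainNorm m W s f ≤ ∑' i, ‖c i‖ₑ :=
  (iInf₂_le c A).trans (iInf_le _ h)

theorem mem_domainSpace_iff {f : I →ₘ[m] ℂ} :
    f ∈ domainSpace m W s ↔ f ∈ Lp ℂ (domainExponent s) m ∧ domainNorm m W s f < ∞ := by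
  rw [domainSpace, Set.mem_ofPred_eq, Lp.mem_Lp_iff_memLp]
  refine and_congr_right fun _ => ⟨fun ⟨c, A, h⟩ => (domainNorm_le h).trans_lt h.cost_lt_top,
    fun hlt => ?_⟩
  simp only [domainNorm, iInf_lt_iff] at hlt
  obtain ⟨c, A, h, -⟩ := hlt
  exact ⟨c, A, h⟩

variable [IsFiniteMeasure m]

/-- The Souza atoms of the elements of `W`, as a family of atoms in `L^{1/(1-s)}`. -/
noncomputable def domainAtom (hW : ∀ A ∈ W, MeasurableSet A) (s : ℝ) (A : W) :
    Lp ℂ (domainExponent s) m :=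
  souzaAtomLp s (hW A A.2)

variable [Fact (1 ≤ domainExponent s)]

theorem norm_domainAtom_le_one (hW : ∀ A ∈ W, MeasurableSet A) (A : W) :
    ‖(domainAtom hW s A : Lp ℂ (domainExponent s) m)‖ ≤ 1 :=
  norm_souzaAtomLp_le_one _

theorem isDomainRep_iff (hW : ∀ A ∈ W, MeasurableSet A) {A : ℕ → W} {c : ℕ → ℂ}
    {f : Lp ℂ (domainExponent s) m} :
    IsDomainRep m W s f c (fun i => A i) ↔
      ∑' i, ‖c i‖ₑ < ∞ ∧ HasSum (fun i => c i • domainAtom hW s (A i)) f := by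
  have hsum : ∀ n, ⇑(∑ i ∈ Finset.range n, c i • (domainAtom hW s (A i) : Lp ℂ _ m)) =ᵐ[m]
      fun x => ∑ i ∈ Finset.range n, c i * souzaAtom m s (A i) x := by
    refine fun n => (Lp.coeFn_fun_finsetSum _ _).trans ?_
    filter_upwards [ae_all_iff.2 fun i => smul_souzaAtomLp_coeFn (s := s) (m := m) (c i)
      (hW (A i) (A i).2)] with x hx
    exact Finset.sum_congr rfl fun i _ => hx i
  have hlim := tendsto_eLpNorm_sub_iff (f := f) hsum
  refine ⟨fun h => ⟨h.cost_lt_top, ?_⟩, fun ⟨hc, hf⟩ =>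
    ⟨fun i => (A i).2, hc, hlim.2 hf.tendsto_sum_nat⟩⟩
  exact (summable_smul_of_norm_le (fun i => norm_domainAtom_le_one hW (A i))
    h.cost_lt_top.ne).hasSum_iff_tendsto_nat.2 (hlim.1 h.tendsto)

theorem domainNorm_coe [Nonempty W] (hW : ∀ A ∈ W, MeasurableSet A)
    (f : Lp ℂ (domainExponent s) m) :
    domainNorm m W s f = atomicNorm ℂ (domainAtom hW s) f := by
  refine le_antisymm (le_iInf₂ fun c hc => ?_) (le_iInf₂ fun c A => le_iInf fun h => ?_)
  · rcases eq_top_or_lt_top (∑' A, ‖c A‖ₑ) with htop | hlt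
    · exact htop ▸ le_top
    · obtain ⟨b, A, hb, hcost⟩ := exists_nat_hasSum_smul hlt.ne hc
      exact hcost ▸ domainNorm_le ((isDomainRep_iff hW).2 ⟨hcost ▸ hlt, hb⟩)
  · lift A to ℕ → W using h.mem
    exact (atomicNorm_le_atomicNorm_comp (norm_domainAtom_le_one hW) A f).trans
      (atomicNorm_le_tsum ((isDomainRep_iff hW).1 h).2)

end DomainSpace

section RegularDomain

variable {I : Type*} {G : ℕ → Finset (Set I)} {C c : ℝ}

theorem tsum_ofReal_le_of_geometric {F : ℕ → Finset (Set I)} {φ : Set I → ℝ} {t : ℝ}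
    (hφ : ∀ Q, 0 ≤ φ Q) (hC : 0 ≤ C) (hc₀ : 0 ≤ c) (hc₁ : c < 1) (ht : 0 < t)
    (h : ∀ j, ∑ Q ∈ F j, φ Q ≤ C * c ^ j * t) :
    ∑' x : Cell F, ENNReal.ofReal (φ x.2 / t) ≤ ENNReal.ofReal (C / (1 - c)) := by
  have hgeom := (hasSum_geometric_of_lt_one hc₀ hc₁).mul_left C
  rw [Cell.tsum_eq fun Q => ENNReal.ofReal (φ Q / t), div_eq_mul_inv, ← hgeom.tsum_eq,
    ENNReal.ofReal_tsum_of_nonneg (fun j => by positivity) hgeom.summable]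
  refine ENNReal.tsum_le_tsum fun j => ?_
  rw [← ENNReal.ofReal_sum_of_nonneg fun Q _ => div_nonneg (hφ Q) ht.le, ← Finset.sum_div]
  exact ENNReal.ofReal_le_ofReal ((div_le_iff₀ ht).2 (h j))

variable [MeasurableSpace I] {m : Measure I} [IsFiniteMeasure m] {A : Set I}

theorem IsRegularDomain.exists_decomposition {α : ℝ} (hG : IsGrid m G) (hC : 0 ≤ C)
    (hc₀ : 0 ≤ c) (hc₁ : c < 1) (h : IsRegularDomain m G α C c A) :
    ∃ (k₀ : ℕ) (F : ℕ → Finset (Set I)), (∀ j, F j ⊆ G (k₀ + j)) ∧ ⋃ x : Cell F, ↑x.2 = A ∧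
      (Pairwise (Function.onFun Disjoint fun x : Cell F => (x.2 : Set I))) ∧
      ∑' x : Cell F, ENNReal.ofReal (m.real x.2 ^ α / m.real A ^ α) ≤
        ENNReal.ofReal (C / (1 - c)) := by
  obtain ⟨-, k₀, ⟨⟨P, hP, hPA⟩, -⟩, F, hFG, hAF, hdisj, hdecay⟩ := h
  have hsub : ∀ j, F (k₀ + j) ⊆ G (k₀ + j) := fun j => hFG _ (Nat.le_add_right _ _)
  have hinj : Function.Injective fun x : Cell fun j => F (k₀ + j) => (x.2 : Set I) :=
    Cell.coe_injective fun i j hij Q hQ R hR => hG.levels_distinct _ _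
      (fun h => hij (Nat.add_left_cancel h)) Q (hsub i hQ) R (hsub j hR)
  refine ⟨k₀, fun j => F (k₀ + j), hsub, ?_, fun x y hxy => ?_, ?_⟩
  · rw [hAF]
    ext y
    simp only [Set.mem_iUnion, Sigma.exists, Subtype.exists]
    constructor
    · rintro ⟨j, Q, hQ, hy⟩
      exact ⟨k₀ + j, Nat.le_add_right _ _, Q, hQ, hy⟩
    · rintro ⟨k, hk, Q, hQ, hy⟩
      obtain ⟨j, rfl⟩ := Nat.exists_eq_add_of_le hk
      exact ⟨j, Q, hQ, hy⟩
  · exact hdisj _ (Nat.le_add_right _ _) _ (Nat.le_add_right _ _) _ x.2.2 _ y.2.2 (hinj.ne hxy)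
  · have hA : 0 < m.real A :=
      (hG.measureReal_pos ⟨k₀, P, hP⟩).trans_le (measureReal_mono hPA)
    refine tsum_ofReal_le_of_geometric (φ := fun Q => m.real Q ^ α) (fun Q => by positivity)
      hC hc₀ hc₁ (by positivity) fun j => ?_
    simpa only [Nat.add_sub_cancel_left] using hdecay (k₀ + j) (Nat.le_add_right _ _)

theorem IsRegularDomain.exists_hasSum_cellAtom {s : ℝ} [Fact (1 ≤ domainExponent s)]
    (hG : IsGrid m G) (hC : 0 ≤ C) (hc₀ : 0 ≤ c) (hc₁ : c < 1)
    (h : IsRegularDomain m G (1 - s) C c A) :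
    ∃ d : Cell G → ℂ, HasSum (fun x => d x • cellAtom hG s x) (souzaAtomLp s h.1) ∧
      ∑' x, ‖d x‖ₑ ≤ ENNReal.ofReal (C / (1 - c)) := by
  obtain ⟨k₀, F, hFG, hA, hdisj, hsum⟩ := h.exists_decomposition hG hC hc₀ hc₁
  let e : Cell F → Cell G := fun x => ⟨k₀ + x.1, x.2, hFG x.1 x.2.2⟩
  have he : e.Injective := by
    rintro ⟨i, P, hP⟩ ⟨j, Q, hQ⟩ hPQ
    obtain ⟨hij, hPQ⟩ := Sigma.mk.inj hPQ
    obtain rfl := Nat.add_left_cancel hij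
    obtain rfl : P = Q := congrArg Subtype.val (eq_of_heq hPQ)
    rfl
  refine ⟨Function.extend e
    (fun x => ((m.real x.2 ^ (1 - s) / m.real A ^ (1 - s) : ℝ) : ℂ)) 0, ?_, ?_⟩
  · rw [hasSum_extend_zero_smul he]
    exact hasSum_smul_souzaAtomLp_of_iUnion_eq (fun x => hG.measurableSet _ _ (e x).2.2)
      (fun x => hG.measureReal_pos (e x)) hdisj h.1 hA
  · rw [tsum_enorm_extend_zero he]
    refine (tsum_congr fun x => ?_).trans_le hsum
    rw [← ofReal_norm, Complex.norm_real, Real.norm_of_nonneg (by positivity)]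

end RegularDomain

section Comparison

variable {I : Type*} [MeasurableSpace I] {m : Measure I}
  {G : ℕ → Finset (Set I)} {s : ℝ} {W : Set (Set I)}

theorem IsGrid.nonempty_of_forall_mem (hG : IsGrid m G) (hGW : ∀ k, ∀ Q ∈ G k, Q ∈ W) :
    Nonempty W :=
  let ⟨k, Q, hQ⟩ := hG.exists_nonempty
  ⟨⟨Q, hGW k Q hQ⟩⟩

variable [IsFiniteMeasure m] [Fact (1 ≤ domainExponent s)]

theorem domainNorm_le_besovNorm (hG : IsGrid m G) (hGW : ∀ k, ∀ Q ∈ G k, Q ∈ W)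
    (hW : ∀ A ∈ W, MeasurableSet A) (f : Lp ℂ (domainExponent s) m) :
    domainNorm m W s f ≤ besovNorm m G s f := by
  have := hG.nonempty_of_forall_mem hGW
  let e : Cell G → W := fun x => ⟨x.2, hGW x.1 x.2 x.2.2⟩
  have he : (fun x => domainAtom hW s (e x)) = cellAtom hG s := rfl
  rw [domainNorm_coe hW, besovNorm_coe hG, ← he]
  exact atomicNorm_le_atomicNorm_comp (norm_domainAtom_le_one hW) e f

theorem besovNorm_le_mul_domainNorm [Nonempty W] (hG : IsGrid m G) {C c : ℝ} (hC : 0 < C)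
    (hc₀ : 0 ≤ c) (hc₁ : c < 1) (hW : ∀ A ∈ W, IsRegularDomain m G (1 - s) C c A)
    (f : Lp ℂ (domainExponent s) m) :
    besovNorm m G s f ≤ ENNReal.ofReal (C / (1 - c)) * domainNorm m W s f := by
  rw [domainNorm_coe fun A hA => (hW A hA).1, besovNorm_coe hG]
  refine atomicNorm_le_mul (norm_cellAtom_le_one hG) ?_ ENNReal.ofReal_ne_top (fun A => ?_) f
  · exact (ENNReal.ofReal_pos.2 (div_pos hC (sub_pos.2 hc₁))).ne'
  · exact (hW A A.2).exists_hasSum_cellAtom hG hC.le hc₀ hc₁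

end Comparison

end GridBesov

theorem proposition18p1_general {I : Type*} [MeasurableSpace I] {m : Measure I}
    [IsFiniteMeasure m] {G : ℕ → Finset (Set I)} (hG : GridBesov.IsGrid m G)
    {s : ℝ} (hs₀ : 0 ≤ s) (hs₁ : s < 1) {C c : ℝ} (hC : 0 < C) (hc₀ : 0 ≤ c) (hc₁ : c < 1)
    {W : Set (Set I)} (hGW : ∀ k, ∀ Q ∈ G k, Q ∈ W)
    (hW : ∀ A ∈ W, GridBesov.IsRegularDomain m G (1 - s) C c A) :
    GridBesov.domainSpace m W s = GridBesov.besovSpace m G s ∧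
      ∀ f ∈ GridBesov.domainSpace m W s,
        GridBesov.domainNorm m W s f ≤ GridBesov.besovNorm m G s f ∧
        GridBesov.besovNorm m G s f ≤
          ENNReal.ofReal (C / (1 - c)) * GridBesov.domainNorm m W s f := by
  have : Fact (1 ≤ GridBesov.domainExponent s) := ⟨GridBesov.one_le_domainExponent hs₀ hs₁⟩
  have : Nonempty W := hG.nonempty_of_forall_mem hGW
  have hle := GridBesov.domainNorm_le_besovNorm (s := s) hG hGW fun A hA => (hW A hA).1
  have hge := GridBesov.besovNorm_le_mul_domainNorm hG hC hc₀ hc₁ hW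
  refine ⟨Set.ext fun f => ?_, fun f hf => ?_⟩
  · rw [GridBesov.mem_domainSpace_iff, GridBesov.mem_besovSpace_iff hG]
    refine and_congr_right fun hf => ⟨fun hlt => ?_, (hle ⟨f, hf⟩).trans_lt⟩
    exact (hge ⟨f, hf⟩).trans_lt (ENNReal.mul_lt_top ENNReal.ofReal_lt_top hlt)
  · have hfp := (GridBesov.mem_domainSpace_iff.1 hf).1
    exact ⟨hle ⟨f, hfp⟩, hge ⟨f, hfp⟩⟩

theorem proposition18p1 {I : Type*} [MeasurableSpace I] (m : Measure I) [IsFiniteMeasure m]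
    (G : ℕ → Finset (Set I)) (lam₁ lam₂ : ℝ) (hG : GridBesov.IsGoodGrid m G lam₁ lam₂)
    (s : ℝ) (hs₀ : 0 < s) (hs₁ : s < 1)
    (C c : ℝ) (hC : 1 ≤ C) (hc₀ : 0 < c) (hc₁ : c < 1)
    (W : Set (Set I)) (hGW : ∀ k, ∀ Q ∈ G k, Q ∈ W)
    (hW : ∀ A ∈ W, GridBesov.IsRegularDomain m G (1 - s) C c A) :
    GridBesov.domainSpace m W s = GridBesov.besovSpace m G s ∧
      ∃ K₁ K₂ : ℝ≥0, 0 < K₁ ∧ 0 < K₂ ∧ ∀ f ∈ GridBesov.domainSpace m W s,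
        GridBesov.domainNorm m W s f ≤ K₁ * GridBesov.besovNorm m G s f ∧
        GridBesov.besovNorm m G s f ≤ K₂ * GridBesov.domainNorm m W s f := by
  obtain ⟨heq, hnorm⟩ := proposition18p1_general hG.toIsGrid hs₀.le hs₁ (one_pos.trans_le hC)
    hc₀.le hc₁ hGW hW
  refine ⟨heq, 1, (C / (1 - c)).toNNReal, one_pos,
    Real.toNNReal_pos.2 (div_pos (one_pos.trans_le hC) (sub_pos.2 hc₁)), fun f hf => ?_⟩
  rw [ENNReal.coe_one, one_mul]
  exact hnorm f hf
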